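/- A $(0,1)$-matrix is simple if it has no repeated columns. For $(0,1)$-matrices $F$ and $A$, $F$ is a configuration in $A$ if some submatrix of $A$ is a row and column permutation of $F$. Let $\mathrm{Avoid}(m,F)$ be the set of simple $m$-rowed matrices in which $F$ is not a configuration, let $\mathrm{forb}(m,F)$ be the maximum number of columns of a matrix in $\mathrm{Avoid}(m,F)$, and call $A\in\mathrm{Avoid}(m,F)$ extremal if it has exactly $\mathrm{forb}(m,F)$ columns. Let $F(0,9,1,0)$ be the $2\times 10$ matrix with nine columns $\binom{1}{0}$ and one column $\binom{0}{1}$, and let $K_5\setminus\mathbf 1_5$ be the $5\times 31$ matrix whose columns are all the $(0,1)$-columns on $5$ rows except the column $\mathbf 1_5$ of 1's. Then for every $m$ $$\mathrm{forb}(m,F(0,9,1,0))\le\Big\lfloor\frac{31}{5}m\Big\rfloor+1,$$ with equality for $m\equiv 0\pmod 5$. Moreover, for $m\equiv0\pmod 5$, an $m$-rowed $(0,1)$-matrix is extremal for $F(0,9,1,0)$ if and only if it is, up to permutations of rows and columns, the matrix $$\left[\begin{array}{c|c|c|c|c} K_5\setminus\mathbf 1_5&\mathbf 1&\cdots&\mathbf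 1&\mathbf 1_5\\ \hline \mathbf 0&K_5\setminus\mathbf 1_5&\cdots&\mathbf 1&\mathbf 1_5\\ \hline \vdots&&\ddots&&\vdots\\ \hline \mathbf 0&\mathbf 0&\cdots&K_5\setminus\mathbf 1_5&\mathbf 1_5 \end{array}\right]$$ with $m/5$ diagonal blocks $K_5\setminus\mathbf 1_5$, blocks of 1's above the diagonal, blocks of 0's below it, and one final column of 1's. -/

import Mathlib

/-! (0,1)-matrices are matrices with entries in `Fin 2`. Rows and columns may be indexed by
arbitrary types; an `m`-rowed matrix with `n` columns is a `Matrix (Fin m) (Fin n) (Fin 2)`. -/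

namespace ForbConfig

/-- A (0,1)-matrix is simple if it has no repeated columns. -/
def IsSimple {α β : Type*} (A : Matrix α β (Fin 2)) : Prop :=
  Function.Injective A.transpose

/-- `F` is a configuration in `A`: some submatrix of `A` is a row and column permutation of `F`.
The injections `r` and `c` choose the rows and columns of the submatrix and order them as in `F`. -/
def IsConfig {κ ι α β : Type*} (F : Matrix κ ι (Fin 2)) (A : Matrix α β (Fin 2)) : Prop :=
  ∃ (r : κ ↪ α) (c : ι ↪ β), A.submatrix r c = F

/-- The matrices with `m` rows and `n` columns in `Avoid(m, F)`:
simple matrices without the configuration `F`. -/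
def Avoid {κ ι : Type*} (m n : ℕ) (F : Matrix κ ι (Fin 2)) :
    Set (Matrix (Fin m) (Fin n) (Fin 2)) :=
  {A | IsSimple A ∧ ¬ IsConfig F A}

/-- `forb(m, F)`, the maximum number of columns of a matrix in `Avoid(m, F)`. -/
noncomputable def forb {κ ι : Type*} (m : ℕ) (F : Matrix κ ι (Fin 2)) : ℕ :=
  sSup {n | (Avoid m n F).Nonempty}

/-- If `F` has a column, then the supremum defining `forb(m, F)` is a maximum. -/
theorem isGreatest_forb {κ ι : Type*} [Nonempty ι] (m : ℕ) (F : Matrix κ ι (Fin 2)) :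
    IsGreatest {n | (Avoid m n F).Nonempty} (forb m F) := by
  have hb : BddAbove {n | (Avoid m n F).Nonempty} := by
    refine ⟨2 ^ m, ?_⟩
    rintro n ⟨A, hA, -⟩
    simpa using Fintype.card_le_of_injective _ hA
  have hne : {n | (Avoid m n F).Nonempty}.Nonempty := by
    refine ⟨0, Matrix.of fun _ j => j.elim0, fun j => j.elim0, ?_⟩
    rintro ⟨-, c, -⟩
    exact (c (Classical.arbitrary ι)).elim0
  exact ⟨Nat.sSup_mem hne hb, fun n hn => le_csSup hb hn⟩

/-- `A` is extremal, i.e. `A ∈ Ext(m, F)`: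
`A` is in `Avoid(m, F)` and has exactly `forb(m, F)` columns. -/
def IsExtremal {κ ι : Type*} {m n : ℕ} (F : Matrix κ ι (Fin 2))
    (A : Matrix (Fin m) (Fin n) (Fin 2)) : Prop :=
  A ∈ Avoid m n F ∧ n = forb m F

/-- `F(0,p,1,0)`: the `2 × (p+1)` matrix with `p` columns `(1,0)ᵀ` followed by a column `(0,1)ᵀ`. -/
def F0p10 (p : ℕ) : Matrix (Fin 2) (Fin (p + 1)) (Fin 2) :=
  Matrix.of fun i j => if j.val < p then (if i = 0 then 1 else 0) else (if i = 0 then 0 else 1)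

/-- `K_k`, the matrix of all (0,1)-columns on `k` rows (the columns are indexed by themselves). -/
def K (k : ℕ) : Matrix (Fin k) (Fin k → Fin 2) (Fin 2) :=
  Matrix.of fun i c => c i

/-- `K_k \ 1_k`, the matrix `K_k` without the column of 1's. -/
def KMinusOnes (k : ℕ) : Matrix (Fin k) {c : Fin k → Fin 2 // c ≠ fun _ => 1} (Fin 2) :=
  (K k).submatrix id Subtype.val

/-- The triangular construction with `t` diagonal blocks, all equal to `B`: blocks of 1's above the
diagonal, blocks of 0's below the diagonal, and one further column of 1's. -/
def triangular {κ ι : Type*} (t : ℕ) (B : Matrix κ ι (Fin 2)) :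
    Matrix (Fin t × κ) ((Fin t × ι) ⊕ Unit) (Fin 2) :=
  Matrix.of fun x y =>
    match y with
    | Sum.inl y => if x.1 = y.1 then B x.2 y.2 else if x.1 < y.1 then 1 else 0
    | Sum.inr _ => 1

/-- `A` is obtained from `B` by permuting (relabelling) rows and columns. -/
def PermEquiv {α β γ δ : Type*} (A : Matrix α β (Fin 2)) (B : Matrix γ δ (Fin 2)) : Prop :=
  ∃ (e : α ≃ γ) (f : β ≃ δ), A = B.submatrix e f

end ForbConfig

namespace ForbConfig

open Finset

/-! Read columns as sets of rows. Write r(i) for `rowCount` and d(i,j) for `diffCount`, so that r(i)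
- r(j) = d(i,j) - d(j,i). Avoidance says that d(i,j) ≥ 9 forces d(j,i) = 0. Hence r(i) ≥ r(j) + 9
makes every set containing j contain i, while r(i) ≤ r(j) + 8 gives d(i,j) ≤ 8.

In `five_mul_card_le`, take a minimal nonempty set T of rows whose counts all exceed those outside T
by at least 9. Any set meeting the complement of T contains T. So the family splits into proper
subsets of T, and sets containing T, which become a family on the remaining rows. By minimality, the
counts in T have no gap of 9 or more. It remains to show that such a family of proper subsets of T
has at most 31|T|/5 members, with equality only for |T| = 5. The extra 1 in the bound is the full
set.

For |T| ≤ 5 this is the trivial bound 2^|T| - 1. For |T| ≥ 6 the inequality is strict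
(`card_lt_of_no_gap`). If all counts lie within 8 of each other, double count pairs separated by a
set (`card_lt_of_diffCount_le`). Otherwise sort the rows and let D ≥ 9 be the total drop: one
estimate is good for large D (`card_add_le_of_gap`), another for small D (`two_mul_card_add_le`).

Equality forces blocks of five rows, linearly ordered by implication. The triangular matrix has
every column compatible with this order, so counting identifies the two. -/

/-- The number of sets of the family that contain `i`. -/
def rowCount {α : Type*} [DecidableEq α] (𝓕 : Finset (Finset α)) (i : α) : ℕ :=
  #{A ∈ 𝓕 | i ∈ A}

/-- The number of sets of the family that contain `i` but not `j`. -/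
def diffCount {α : Type*} [DecidableEq α] (𝓕 : Finset (Finset α)) (i j : α) : ℕ :=
  #{A ∈ 𝓕 | i ∈ A ∧ j ∉ A}

/-- The set family form of avoiding `F(0,9,1,0)`. -/
def DiffBounded {α : Type*} [DecidableEq α] (𝓕 : Finset (Finset α)) (S : Finset α) : Prop :=
  ∀ i ∈ S, ∀ j ∈ S, 9 ≤ diffCount 𝓕 i j → diffCount 𝓕 j i = 0

/-! ### Pairwise differences and double counting -/

section General

variable {α : Type*} [DecidableEq α] {𝓕 : Finset (Finset α)} {S : Finset α}

theorem rowCount_add_diffCount (𝓕 : Finset (Finset α)) (i j : α) :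
    rowCount 𝓕 i + diffCount 𝓕 j i = rowCount 𝓕 j + diffCount 𝓕 i j := by
  have key : ∀ i j : α, rowCount 𝓕 i + diffCount 𝓕 j i = #{A ∈ 𝓕 | i ∈ A ∨ j ∈ A} := by
    intro i j
    unfold rowCount diffCount
    rw [← card_union_of_disjoint]
    · congr 1
      ext A
      simp only [mem_union, mem_filter]
      tauto
    · rw [disjoint_left]
      intro A
      simp only [mem_filter]
      tauto
  rw [key, key]
  simp only [or_comm]

/-- A difference of 9 or more would kill the opposite difference, and so would itself equal the gap
between the row counts. -/
theorem DiffBounded.diffCount_le (h : DiffBounded 𝓕 S) {i j : α} (hi : i ∈ S) (hj : j ∈ S)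
    (hr : rowCount 𝓕 i ≤ rowCount 𝓕 j + 8) : diffCount 𝓕 i j ≤ 8 := by
  have h1 := h i hi j hj
  have h2 := rowCount_add_diffCount 𝓕 i j
  omega

theorem DiffBounded.diffCount_eq_zero (h : DiffBounded 𝓕 S) {i j : α} (hi : i ∈ S) (hj : j ∈ S)
    (hr : rowCount 𝓕 j + 9 ≤ rowCount 𝓕 i) : diffCount 𝓕 j i = 0 := by
  have h1 := h i hi j hj
  have h2 := rowCount_add_diffCount 𝓕 i j
  omega

theorem mem_of_diffCount_eq_zero {i j : α} (h : diffCount 𝓕 j i = 0) {A : Finset α} (hA : A ∈ 𝓕)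
    (hj : j ∈ A) : i ∈ A := by
  by_contra hi
  rw [diffCount, card_eq_zero] at h
  exact notMem_empty A (h ▸ mem_filter.2 ⟨hA, hj, hi⟩)

/-- Families of proper subsets in which all differences are small, by double counting. -/
theorem card_lt_of_diffCount_le (hS : 6 ≤ #S) (hsub : ∀ A ∈ 𝓕, A ⊂ S)
    (h : ∀ i ∈ S, ∀ j ∈ S, diffCount 𝓕 i j ≤ 8) : 5 * #𝓕 < 31 * #S := by
  have hcount : ∑ A ∈ 𝓕, #A * (#S - #A) = ∑ i ∈ S, ∑ j ∈ S, diffCount 𝓕 i j := by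
    have : ∀ A ∈ 𝓕, #A * (#S - #A) =
        ∑ i ∈ S, ∑ j ∈ S, if i ∈ A ∧ j ∉ A then 1 else 0 := by
      intro A hA
      have hAS := (hsub A hA).1
      rw [← card_sdiff_of_subset hAS, ← card_product, ← sum_product', ← card_filter]
      congr 1
      ext ⟨i, j⟩
      simp only [mem_product, mem_sdiff, mem_filter]
      have := @hAS i
      tauto
    rw [sum_congr rfl this, sum_comm]
    refine sum_congr rfl fun i _ => ?_
    rw [sum_comm]
    refine sum_congr rfl fun j _ => ?_
    rw [diffCount, card_filter]
  have hupper : ∑ i ∈ S, ∑ j ∈ S, diffCount 𝓕 i j ≤ 8 * (#S * (#S - 1)) := by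
    have : ∀ i ∈ S, ∑ j ∈ S, diffCount 𝓕 i j ≤ 8 * (#S - 1) := by
      intro i hi
      rw [← add_sum_erase _ _ hi]
      have h0 : diffCount 𝓕 i i = 0 := by simp [diffCount]
      have := sum_le_card_nsmul (S.erase i) (fun j => diffCount 𝓕 i j) 8
        fun j hj => h i hi j (mem_of_mem_erase hj)
      rw [card_erase_of_mem hi, smul_eq_mul] at this
      omega
    have := sum_le_card_nsmul S _ _ this
    rw [smul_eq_mul] at this
    linarith
  have hone : #{A ∈ 𝓕 | #A = 1} ≤ #S := by
    have : {A ∈ 𝓕 | #A = 1} ⊆ S.powersetCard 1 := by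
      intro A hA
      rw [mem_filter] at hA
      exact mem_powersetCard.2 ⟨(hsub A hA.1).1, hA.2⟩
    simpa using card_le_card this
  have hco : #{A ∈ 𝓕 | #A = #S - 1} ≤ #S := by
    have : {A ∈ 𝓕 | #A = #S - 1} ⊆ S.powersetCard (#S - 1) := by
      intro A hA
      rw [mem_filter] at hA
      exact mem_powersetCard.2 ⟨(hsub A hA.1).1, hA.2⟩
    have := card_le_card this
    rwa [card_powersetCard, Nat.choose_symm (by omega), Nat.choose_one_right] at this
  have hzero : #{A ∈ 𝓕 | #A = 0} ≤ 1 := by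
    have : {A ∈ 𝓕 | #A = 0} ⊆ {∅} := by
      intro A hA
      rw [mem_filter, card_eq_zero] at hA
      exact mem_singleton.2 hA.2
    simpa using card_le_card this
  obtain ⟨d, hd⟩ : ∃ d, #S = d + 6 := ⟨#S - 6, by omega⟩
  -- With s = #S, a set of size 2 to s - 2 separates at least 2(s - 2) ordered pairs. Singletons and
  -- their complements fall short of this by s - 3, the empty set by all of it.
  have hlower : ∀ A ∈ 𝓕, 2 * (d + 4) ≤ #A * (#S - #A) + ((d + 3) * (if #A = 1 then 1 else 0) +
      (d + 3) * (if #A = #S - 1 then 1 else 0) + 2 * (d + 4) * (if #A = 0 then 1 else 0)) := by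
    intro A hA
    have hlt := card_lt_card (hsub A hA)
    rcases Nat.eq_zero_or_pos #A with h0 | h0
    · simp [h0]
    by_cases h1 : #A = 1
    · rw [h1, hd]; simp; omega
    by_cases h2 : #A = #S - 1
    · have : #S - #A = 1 := by omega
      rw [this, if_pos h2]; omega
    obtain ⟨a, ha⟩ : ∃ a, #A = a + 2 := ⟨#A - 2, by omega⟩
    obtain ⟨b, hb⟩ : ∃ b, #S - #A = b + 2 := ⟨#S - #A - 2, by omega⟩
    have : d + 2 = a + b := by omega
    refine le_trans ?_ (Nat.le_add_right _ _)
    rw [hb, ha]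
    nlinarith [Nat.zero_le (a * b)]
  have hsum := sum_le_sum hlower
  rw [sum_const, smul_eq_mul, sum_add_distrib, sum_add_distrib, sum_add_distrib, ← mul_sum,
    ← mul_sum, ← mul_sum, ← card_filter, ← card_filter, ← card_filter, hcount] at hsum
  have e1 : #S - 1 = d + 5 := by omega
  rw [e1] at hupper hsum hco
  rw [hd] at hone hco hupper ⊢
  have h3 : #𝓕 * (2 * (d + 4)) ≤ 8 * ((d + 6) * (d + 5)) + ((d + 3) * (d + 6) + (d + 3) * (d + 6)
      + 2 * (d + 4) * 1) := by
    refine hsum.trans (add_le_add hupper ?_)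
    gcongr
  -- What remains is 6s² - 32s + 10 > 0, which holds for s ≥ 6 and degenerates to equality at s = 5.
  by_contra hcon
  push Not at hcon
  nlinarith

end General

/-! ### Sorted row counts: ascents and incidences -/

section Sorted

variable {𝓕 : Finset (Finset ℕ)} {n : ℕ}

theorem exists_ascent {A : Finset ℕ} (hA : A ⊆ range (n + 1)) (hne : A ≠ range #A) :
    ∃ i < n, i + 1 ∈ A ∧ i ∉ A := by
  by_contra! hcon
  have hdown : ∀ k i, i + k ∈ A → i ∈ A := by
    intro k
    induction k with
    | zero => simp
    | succ k ih =>
      intro i hi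
      have := mem_range.1 (hA hi)
      exact ih i (hcon (i + k) (by omega) hi)
  have : range #A ⊆ A ∨ A ⊆ range #A := by
    by_cases h : ∃ k ∈ A, #A ≤ k
    · obtain ⟨k, hk, hkA⟩ := h
      left
      intro i hi
      have := mem_range.1 hi
      exact hdown (k - i) i (by rwa [Nat.add_sub_cancel' (by omega)])
    · push Not at h
      exact Or.inr fun k hk => mem_range.2 (h k hk)
  rcases this with h | h
  · exact hne (eq_of_subset_of_card_le h (by simp)).symm
  · exact hne (eq_of_subset_of_card_le h (by simp))

/-- Sets that are not initial segments are counted by their ascents. -/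
theorem card_le_add_sum_diffCount (hsub : ∀ A ∈ 𝓕, A ⊂ range (n + 1)) :
    #𝓕 ≤ (n + 1) + ∑ i ∈ range n, diffCount 𝓕 (i + 1) i := by
  have : 𝓕 ⊆ (range (n + 1)).image range ∪
      (range n).biUnion fun i => {A ∈ 𝓕 | i + 1 ∈ A ∧ i ∉ A} := by
    intro A hA
    by_cases hne : A = range #A
    · refine mem_union_left _ (mem_image.2 ⟨#A, ?_, hne.symm⟩)
      simpa using card_lt_card (hsub A hA)
    · obtain ⟨i, hi, h⟩ := exists_ascent (hsub A hA).1 hne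
      exact mem_union_right _ (mem_biUnion.2 ⟨i, mem_range.2 hi, mem_filter.2 ⟨hA, h⟩⟩)
  refine (card_le_card this).trans ((card_union_le _ _).trans (add_le_add ?_ card_biUnion_le))
  simpa using card_image_le (s := range (n + 1)) (f := range)

/-- Each d(k+1,k) equals d(k,k+1) minus the drop from r(k) to r(k+1), hence is at most 8 minus that
drop. The drops telescope in the ascent count. -/
theorem card_add_le_of_gap (hsub : ∀ A ∈ 𝓕, A ⊂ range (n + 1))
    (hb : DiffBounded 𝓕 (range (n + 1)))
    (hgap : ∀ i < n, rowCount 𝓕 i ≤ rowCount 𝓕 (i + 1) + 8) :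
    #𝓕 + rowCount 𝓕 0 ≤ (n + 1) + 8 * n + rowCount 𝓕 n := by
  have h1 := card_le_add_sum_diffCount hsub
  have h2 : ∀ k ≤ n, ∑ i ∈ range k, diffCount 𝓕 (i + 1) i + rowCount 𝓕 0 ≤
      8 * k + rowCount 𝓕 k := by
    intro k
    induction k with
    | zero => simp
    | succ k ih =>
      intro hk
      rw [sum_range_succ]
      have h3 := ih (by omega)
      have h4 := hb.diffCount_le (i := k) (j := k + 1) (mem_range.2 (by omega))
        (mem_range.2 (by omega)) (hgap k (by omega))
      have h5 := rowCount_add_diffCount 𝓕 k (k + 1)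
      omega
  have := h2 n le_rfl
  omega

/-- Every nonempty set has two incidences unless it is a singleton, and each point accounts for at
most one singleton. -/
theorem two_mul_card_le {γ : Type*} [DecidableEq γ] (𝓗 : Finset (Finset γ)) (T : Finset γ)
    (hsub : ∀ A ∈ 𝓗, A ⊆ T) (hne : ∀ A ∈ 𝓗, A ≠ ∅) :
    2 * #𝓗 ≤ ∑ j ∈ T, (rowCount 𝓗 j + if rowCount 𝓗 j = 0 then 0 else 1) := by
  have hcard : ∑ A ∈ 𝓗, #A = ∑ j ∈ T, rowCount 𝓗 j := by
    have : ∀ A ∈ 𝓗, #A = ∑ j ∈ T, if j ∈ A then 1 else 0 := by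
      intro A hA
      rw [← card_filter, filter_mem_eq_inter, inter_eq_right.2 (hsub A hA)]
    rw [sum_congr rfl this, sum_comm]
    exact sum_congr rfl fun j _ => (card_filter _ _).symm
  have hsingle : #{A ∈ 𝓗 | #A = 1} ≤ ∑ j ∈ T, if rowCount 𝓗 j = 0 then 0 else 1 := by
    have hsub' : {A ∈ 𝓗 | #A = 1} ⊆ {j ∈ T | rowCount 𝓗 j ≠ 0}.image singleton := by
      intro A hA
      obtain ⟨hA, h1⟩ := mem_filter.1 hA
      obtain ⟨j, rfl⟩ := card_eq_one.1 h1
      refine mem_image.2 ⟨j, mem_filter.2 ⟨hsub _ hA (mem_singleton_self j), ?_⟩, rfl⟩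
      exact (card_pos.2 ⟨{j}, mem_filter.2 ⟨hA, mem_singleton_self j⟩⟩).ne'
    have := (card_le_card hsub').trans card_image_le
    simpa only [card_filter, ne_eq, ite_not] using this
  have hlow : ∀ A ∈ 𝓗, 2 ≤ #A + if #A = 1 then 1 else 0 := by
    intro A hA
    have := card_pos.2 (nonempty_iff_ne_empty.2 (hne A hA))
    split_ifs <;> omega
  have := sum_le_sum hlow
  rw [sum_const, smul_eq_mul, sum_add_distrib, ← card_filter, hcard] at this
  rw [sum_add_distrib]
  omega

end Sorted

/-! ### Sorted row counts with a large total drop -/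

section Sorted

variable {𝓕 : Finset (Finset ℕ)} {n : ℕ}

/-- The indices whose row count is far from both the first and the last one. -/
def farIndices (𝓕 : Finset (Finset ℕ)) (n : ℕ) : Finset ℕ :=
  {j ∈ Ico 1 n | rowCount 𝓕 n + 9 ≤ rowCount 𝓕 j ∧ rowCount 𝓕 j + 9 ≤ rowCount 𝓕 0}

/-- Descending in steps of at most 8, the counts cannot cross the middle range without landing on
far indices; each of these pays for one step. -/
theorem rowCount_zero_le_farIndices
    (hgap : ∀ i < n, rowCount 𝓕 i ≤ rowCount 𝓕 (i + 1) + 8) :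
    rowCount 𝓕 0 ≤ rowCount 𝓕 n + 24 + 8 * #(farIndices 𝓕 n) := by
  -- The 16 is 8 + 8: a count within 8 of r(n) has a predecessor at most 8 higher, so the maximum
  -- absorbs the step below the middle range.
  have key : ∀ k ≤ n, rowCount 𝓕 0 ≤ 8 + 8 * #{j ∈ farIndices 𝓕 n | j ≤ k} +
      max (rowCount 𝓕 k) (rowCount 𝓕 n + 16) := by
    intro k
    induction k with
    | zero => intro _; omega
    | succ k ih =>
      intro hk
      have h1 := ih (by omega)
      have h2 := hgap k (by omega)
      have hmono : {j ∈ farIndices 𝓕 n | j ≤ k} ⊆ {j ∈ farIndices 𝓕 n | j ≤ k + 1} :=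
        monotone_filter_right _ fun j _ hj => Nat.le_succ_of_le hj
      have h3 := card_le_card hmono
      by_cases hfar : k + 1 ∈ farIndices 𝓕 n
      · have hlt : #{j ∈ farIndices 𝓕 n | j ≤ k} < #{j ∈ farIndices 𝓕 n | j ≤ k + 1} := by
          refine card_lt_card (ssubset_iff_of_subset hmono |>.2 ⟨k + 1, ?_, ?_⟩)
          · exact mem_filter.2 ⟨hfar, le_rfl⟩
          · simp
        omega
      · have : k + 1 = n ∨ rowCount 𝓕 (k + 1) < rowCount 𝓕 n + 9 ∨
            rowCount 𝓕 0 < rowCount 𝓕 (k + 1) + 9 := by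
          by_contra! hcon
          exact hfar (mem_filter.2 ⟨mem_Ico.2 ⟨by omega, by omega⟩, by omega, by omega⟩)
        rcases this with h | h
        · subst h; omega
        · omega
  have h1 := key n le_rfl
  have h2 := card_filter_le (farIndices 𝓕 n) (· ≤ n)
  omega

/-- Row n implies row 0. So the sets missing 0, and the complements of the sets containing n, live
on the rows strictly between; `two_mul_card_le` applies to both families. -/
theorem two_mul_card_add_le (hsub : ∀ A ∈ 𝓕, A ⊂ range (n + 1))
    (hb : DiffBounded 𝓕 (range (n + 1)))
    (hanti : ∀ i j, i ≤ j → j ≤ n → rowCount 𝓕 j ≤ rowCount 𝓕 i)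
    (hD : rowCount 𝓕 n + 9 ≤ rowCount 𝓕 0) :
    2 * #𝓕 + 2 * rowCount 𝓕 n + 9 * #(farIndices 𝓕 n) ≤
      2 * rowCount 𝓕 0 + 2 + 9 * (n - 1) := by
  have hmem0 : 0 ∈ range (n + 1) := by simp
  have hmemn : n ∈ range (n + 1) := by simp
  have h0n : ∀ A ∈ 𝓕, n ∈ A → 0 ∈ A := fun A hA =>
    mem_of_diffCount_eq_zero (hb.diffCount_eq_zero hmem0 hmemn hD) hA
  set 𝓜 : Finset (Finset ℕ) := {A ∈ 𝓕 | 0 ∉ A} with h𝓜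
  set 𝓗 : Finset (Finset ℕ) := {A ∈ 𝓕 | n ∈ A} with h𝓗
  have hsplit : rowCount 𝓕 0 + #𝓜 = #𝓕 := card_filter_add_card_filter_not (s := 𝓕) (0 ∈ ·)
  have hlow := two_mul_card_le (𝓜.erase ∅) (Ico 1 n) (by
    intro A hA j hj
    obtain ⟨hAF, hA0⟩ := mem_filter.1 (mem_of_mem_erase hA)
    have hjn := mem_range.1 ((hsub A hAF).1 hj)
    have hj0 : j ≠ 0 := by rintro rfl; exact hA0 hj
    have hjn' : j ≠ n := by rintro rfl; exact hA0 (h0n A hAF hj)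
    exact mem_Ico.2 ⟨by omega, by omega⟩) (fun A hA => ne_of_mem_erase hA)
  have hinj : Set.InjOn (fun A => range (n + 1) \ A) (𝓗 : Set (Finset ℕ)) := by
    intro A hA B hB hAB
    have hA' := (hsub A (mem_filter.1 hA).1).1
    have hB' := (hsub B (mem_filter.1 hB).1).1
    have := congrArg (range (n + 1) \ ·) hAB
    simpa only [Finset.sdiff_sdiff_eq_self hA', Finset.sdiff_sdiff_eq_self hB'] using this
  have hhigh := two_mul_card_le (𝓗.image fun A => range (n + 1) \ A) (Ico 1 n) (by
    intro B hB j hj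
    obtain ⟨A, hA, rfl⟩ := mem_image.1 hB
    obtain ⟨hAF, hAn⟩ := mem_filter.1 hA
    obtain ⟨hjn, hjA⟩ := mem_sdiff.1 hj
    have hj0 : j ≠ 0 := by rintro rfl; exact hjA (h0n A hAF hAn)
    have hjn' : j ≠ n := by rintro rfl; exact hjA hAn
    have := mem_range.1 hjn
    exact mem_Ico.2 ⟨by omega, by omega⟩) (by
    intro B hB
    obtain ⟨A, hA, rfl⟩ := mem_image.1 hB
    intro h
    exact (hsub A (mem_filter.1 hA).1).2 (sdiff_eq_empty_iff_subset.1 h))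
  rw [card_image_of_injOn hinj] at hhigh
  have hlowcount : ∀ j, rowCount (𝓜.erase ∅) j = diffCount 𝓕 j 0 := by
    intro j
    unfold rowCount diffCount
    congr 1
    ext A
    simp only [mem_filter, mem_erase, h𝓜]
    constructor
    · tauto
    · rintro ⟨hA, hj, h0⟩
      exact ⟨⟨ne_empty_of_mem hj, hA, h0⟩, hj⟩
  have hhighcount : ∀ j ∈ Ico 1 n,
      rowCount (𝓗.image fun A => range (n + 1) \ A) j = diffCount 𝓕 n j := by
    intro j hj
    have hj' : j ∈ range (n + 1) := by have := mem_Ico.1 hj; simp; omega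
    unfold rowCount diffCount
    rw [filter_image, card_image_of_injOn (hinj.mono (coe_subset.2 (filter_subset _ _)))]
    congr 1
    ext A
    simp only [mem_filter, mem_sdiff, hj', true_and, h𝓗]
    tauto
  -- Far rows contribute nothing, as d(j,0) = d(n,j) = 0. If j is far from just one end, one
  -- difference vanishes and the other costs at most 8 + 1. If j is close to both, the differences
  -- total at most 16 - D ≤ 7, plus 2 for the singletons.
  have hpoint : ∀ j ∈ Ico 1 n,
      ((rowCount (𝓜.erase ∅) j + if rowCount (𝓜.erase ∅) j = 0 then 0 else 1) +
      (rowCount (𝓗.image fun A => range (n + 1) \ A) j +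
        if rowCount (𝓗.image fun A => range (n + 1) \ A) j = 0 then 0 else 1)) +
      9 * (if rowCount 𝓕 n + 9 ≤ rowCount 𝓕 j ∧ rowCount 𝓕 j + 9 ≤ rowCount 𝓕 0
        then 1 else 0) ≤ 9 := by
    intro j hj
    rw [hlowcount, hhighcount j hj]
    obtain ⟨hj1, hjn⟩ := mem_Ico.1 hj
    have hj' : j ∈ range (n + 1) := by simp; omega
    have h1 := hanti 0 j (by omega) (by omega)
    have h2 := hanti j n (by omega) (by omega)
    have h3 := hb.diffCount_le hmem0 hj'
    have h4 := hb.diffCount_le hj' hmemn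
    have h5 := hb.diffCount_eq_zero hmem0 hj'
    have h6 := hb.diffCount_eq_zero hj' hmemn
    have h7 := rowCount_add_diffCount 𝓕 0 j
    have h8 := rowCount_add_diffCount 𝓕 j n
    split_ifs <;> omega
  have hsum := sum_le_sum hpoint
  rw [sum_add_distrib, sum_add_distrib, ← mul_sum, ← card_filter, sum_const, Nat.card_Ico,
    smul_eq_mul] at hsum
  have herase : #𝓜 ≤ #(𝓜.erase ∅) + 1 := by
    have := pred_card_le_card_erase (s := 𝓜) (a := ∅)
    omega
  have hrn : rowCount 𝓕 n = #𝓗 := rfl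
  have hfar : #(farIndices 𝓕 n) = #{j ∈ Ico 1 n |
    rowCount 𝓕 n + 9 ≤ rowCount 𝓕 j ∧ rowCount 𝓕 j + 9 ≤ rowCount 𝓕 0} := rfl
  omega

theorem card_lt_of_sorted (hn : 5 ≤ n) (hsub : ∀ A ∈ 𝓕, A ⊂ range (n + 1))
    (hb : DiffBounded 𝓕 (range (n + 1)))
    (hanti : ∀ i j, i ≤ j → j ≤ n → rowCount 𝓕 j ≤ rowCount 𝓕 i)
    (hgap : ∀ i < n, rowCount 𝓕 i ≤ rowCount 𝓕 (i + 1) + 8) :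
    5 * #𝓕 < 31 * (n + 1) := by
  by_cases hD : rowCount 𝓕 n + 9 ≤ rowCount 𝓕 0
  · have h1 := card_add_le_of_gap hsub hb hgap
    have h2 := rowCount_zero_le_farIndices hgap
    have h3 := two_mul_card_add_le hsub hb hanti hD
    -- Weights 7, 9 and 8 on the three estimates eliminate D and the far indices: 23 * #𝓕 ≤ 135 * n
    -- + 167.
    omega
  · have := card_lt_of_diffCount_le (𝓕 := 𝓕) (S := range (n + 1)) (by simp; omega) hsub (by
      intro i hi j hj
      refine hb.diffCount_le hi hj ?_
      rw [mem_range] at hi hj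
      have h1 := hanti 0 i (by omega) (by omega)
      have h2 := hanti j n (by omega) (by omega)
      omega)
    simpa using this

end Sorted

/-! ### Splitting at gaps, and the bound for set families -/

section General

variable {α : Type*} [DecidableEq α]

theorem exists_sorted_enumeration (T : Finset α) (r : α → ℕ) (hT : T.Nonempty) :
    ∃ (n : ℕ) (e : ℕ → α), #T = n + 1 ∧ (range (n + 1)).image e = T ∧
      ∀ i j, i ≤ j → j ≤ n → r (e j) ≤ r (e i) := by
  obtain ⟨n, hn⟩ : ∃ n, #T = n + 1 := ⟨#T - 1, by have := hT.card_pos; omega⟩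
  let f : Fin (n + 1) ≃ T := (T.equivFinOfCardEq hn).symm
  -- The order dual turns the increasing sort into a decreasing one.
  let g : Fin (n + 1) → ℕᵒᵈ := fun i => OrderDual.toDual (r (f i))
  let σ := Tuple.sort g
  have hσ : Monotone (g ∘ σ) := Tuple.monotone_sort g
  have hof : ∀ i, i < n + 1 → ((Fin.ofNat (n + 1) i : Fin (n + 1)) : ℕ) = i :=
    fun i hi => Nat.mod_eq_of_lt hi
  refine ⟨n, fun i => f (σ (Fin.ofNat (n + 1) i)), hn, ?_, ?_⟩
  · ext a
    simp only [mem_image, mem_range]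
    constructor
    · rintro ⟨i, -, rfl⟩
      exact (f _).2
    · intro ha
      refine ⟨σ.symm (f.symm ⟨a, ha⟩), Fin.is_lt _, ?_⟩
      have : (Fin.ofNat (n + 1) (σ.symm (f.symm ⟨a, ha⟩) : ℕ) : Fin (n + 1)) =
          σ.symm (f.symm ⟨a, ha⟩) := Fin.ext (hof _ (Fin.is_lt _))
      rw [this]
      simp
  · intro i j hij hj
    refine @hσ (Fin.ofNat (n + 1) i) (Fin.ofNat (n + 1) j) ?_
    rw [Fin.le_def, hof i (by omega), hof j (by omega)]
    exact hij

/-- Families of proper subsets without a large gap between the row counts. -/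
theorem card_lt_of_no_gap {𝓖 : Finset (Finset α)} {T : Finset α} (hT : 6 ≤ #T)
    (hsub : ∀ A ∈ 𝓖, A ⊂ T) (hb : DiffBounded 𝓖 T)
    (hgap : ∀ U ⊂ T, U.Nonempty → ∃ i ∈ U, ∃ j ∈ T \ U, rowCount 𝓖 i ≤ rowCount 𝓖 j + 8) :
    5 * #𝓖 < 31 * #T := by
  obtain ⟨n, e, hn, hT', hanti⟩ :=
    exists_sorted_enumeration T (rowCount 𝓖) (card_pos.1 (by omega))
  have hmem : ∀ i ≤ n, e i ∈ T := fun i hi =>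
    hT' ▸ mem_image_of_mem e (mem_range.2 (by omega))
  let φ : Finset α → Finset ℕ := fun A => {k ∈ range (n + 1) | e k ∈ A}
  have hφ : ∀ A ⊆ T, (φ A).image e = A := by
    intro A hA
    ext a
    simp only [φ, mem_image, mem_filter]
    constructor
    · rintro ⟨k, ⟨-, h⟩, rfl⟩
      exact h
    · intro ha
      obtain ⟨k, hk, rfl⟩ := mem_image.1 (hT' ▸ hA ha : a ∈ (range (n + 1)).image e)
      exact ⟨k, ⟨hk, ha⟩, rfl⟩
  have hinj : Set.InjOn φ 𝓖 := by
    intro A hA B hB h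
    rw [← hφ A (hsub A hA).1, ← hφ B (hsub B hB).1, h]
  have hcard : #(𝓖.image φ) = #𝓖 := card_image_of_injOn hinj
  have hmemφ : ∀ i ≤ n, ∀ A, i ∈ φ A ↔ e i ∈ A := by
    intro i hi A
    simp only [φ, mem_filter, mem_range]
    exact ⟨And.right, fun h => ⟨by omega, h⟩⟩
  have hrow : ∀ i ≤ n, rowCount (𝓖.image φ) i = rowCount 𝓖 (e i) := by
    intro i hi
    unfold rowCount
    rw [filter_image, card_image_of_injOn (hinj.mono (coe_subset.2 (filter_subset _ _)))]
    simp only [hmemφ i hi]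
  have hdiff : ∀ i ≤ n, ∀ j ≤ n, diffCount (𝓖.image φ) i j = diffCount 𝓖 (e i) (e j) := by
    intro i hi j hj
    unfold diffCount
    rw [filter_image, card_image_of_injOn (hinj.mono (coe_subset.2 (filter_subset _ _)))]
    simp only [hmemφ i hi, hmemφ j hj]
  rw [← hcard, hn]
  refine card_lt_of_sorted (by omega) ?_ ?_ ?_ ?_
  · intro B hB
    obtain ⟨A, hA, rfl⟩ := mem_image.1 hB
    refine ⟨filter_subset _ _, fun h => (hsub A hA).2 ?_⟩
    rw [← hT', image_subset_iff]
    exact fun k hk => (mem_filter.1 (h hk)).2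
  · intro i hi j hj
    have hi' : i ≤ n := Nat.lt_succ_iff.1 (mem_range.1 hi)
    have hj' : j ≤ n := Nat.lt_succ_iff.1 (mem_range.1 hj)
    rw [hdiff i hi' j hj', hdiff j hj' i hi']
    exact hb _ (hmem i hi') _ (hmem j hj')
  · intro i j hij hj
    rw [hrow i (by omega), hrow j hj]
    exact hanti i j hij hj
  · intro i hi
    rw [hrow i (by omega), hrow (i + 1) (by omega)]
    obtain ⟨a, ha, b, hb', hab⟩ := hgap ((range (i + 1)).image e) (by
      refine ⟨?_, fun h => ?_⟩
      · rw [← hT']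
        exact image_subset_image (range_mono (by omega))
      · have := card_le_card h
        have h2 : #((range (i + 1)).image e) ≤ i + 1 := by
          simpa using card_image_le (s := range (i + 1)) (f := e)
        omega) (by simp)
    obtain ⟨k, hk, rfl⟩ := mem_image.1 ha
    obtain ⟨hbT, hbU⟩ := mem_sdiff.1 hb'
    obtain ⟨l, hl, rfl⟩ := mem_image.1 (hT' ▸ hbT : b ∈ (range (n + 1)).image e)
    have hil : i + 1 ≤ l := by
      by_contra! hcon
      exact hbU (mem_image_of_mem e (mem_range.2 hcon))
    have h1 := hanti k i (Nat.lt_succ_iff.1 (mem_range.1 hk)) (by omega)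
    have h2 := hanti (i + 1) l hil (Nat.lt_succ_iff.1 (mem_range.1 hl))
    omega

theorem five_mul_card_le_of_no_gap {𝓖 : Finset (Finset α)} {T : Finset α} (hT : T.Nonempty)
    (hsub : ∀ A ∈ 𝓖, A ⊂ T) (hb : DiffBounded 𝓖 T)
    (hgap : ∀ U ⊂ T, U.Nonempty → ∃ i ∈ U, ∃ j ∈ T \ U, rowCount 𝓖 i ≤ rowCount 𝓖 j + 8) :
    5 * #𝓖 ≤ 31 * #T ∧ (5 * #𝓖 = 31 * #T → #T = 5) := by
  by_cases h6 : 6 ≤ #T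
  · have := card_lt_of_no_gap h6 hsub hb hgap
    omega
  · have hle : #𝓖 ≤ 2 ^ #T - 1 := by
      rw [← card_powerset, ← card_erase_of_mem (mem_powerset_self T)]
      exact card_le_card fun A hA => mem_erase.2 ⟨(hsub A hA).ne, mem_powerset.2 (hsub A hA).1⟩
    have hpos := hT.card_pos
    generalize #T = c at *
    interval_cases c <;> omega

/-- The bound for set families, and the block structure in the case of equality. -/
theorem five_mul_card_le (S : Finset α) : ∀ 𝓕 : Finset (Finset α), (∀ A ∈ 𝓕, A ⊆ S) →
    DiffBounded 𝓕 S → 5 * #𝓕 ≤ 31 * #S + 5 ∧ (5 * #𝓕 = 31 * #S + 5 →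
      ∃ (t : ℕ) (b : α → ℕ), (∀ i ∈ S, b i < t) ∧ (∀ s < t, #{i ∈ S | b i = s} = 5) ∧
        ∀ A ∈ 𝓕, ∀ i ∈ S, ∀ j ∈ S, b i < b j → j ∈ A → i ∈ A) := by
  induction S using Finset.strongInduction with
  | H S ih =>
  intro 𝓕 hsub hb
  rcases S.eq_empty_or_nonempty with rfl | hS
  · have : 𝓕 ⊆ {∅} := fun A hA => mem_singleton.2 (subset_empty.1 (hsub A hA))
    have := card_le_card this
    rw [card_singleton] at this
    exact ⟨by simp; omega, fun _ => ⟨0, fun _ => 0, by simp⟩⟩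
  · let P : Finset α → Prop := fun U =>
      U.Nonempty ∧ ∀ i ∈ U, ∀ j ∈ S \ U, rowCount 𝓕 j + 9 ≤ rowCount 𝓕 i
    -- S itself qualifies vacuously, so a minimal top block exists.
    obtain ⟨T, hTS, ⟨hTne, hTop⟩, hmin⟩ :
        ∃ T ⊆ S, P T ∧ ∀ U ⊂ T, ¬ P U := by
      have hPS : P S := ⟨hS, by simp⟩
      obtain ⟨T, hT, hTmin⟩ := exists_minimal (s := {U ∈ S.powerset | P U})
        ⟨S, by simp [hPS]⟩
      rw [mem_filter, mem_powerset] at hT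
      refine ⟨T, hT.1, hT.2, fun U hU hPU => hU.2 (hTmin ?_ hU.1)⟩
      exact mem_filter.2 ⟨mem_powerset.2 (hU.1.trans hT.1), hPU⟩
    have htop : ∀ A ∈ 𝓕, ∀ i ∈ T, ∀ j ∈ S \ T, j ∈ A → i ∈ A := fun A hA i hi j hj =>
      mem_of_diffCount_eq_zero
        (hb.diffCount_eq_zero (hTS hi) (mem_sdiff.1 hj).1 (hTop i hi j hj)) hA
    set 𝓖 : Finset (Finset α) := {A ∈ 𝓕 | ¬ T ⊆ A} with h𝓖
    set 𝓗 : Finset (Finset α) := {A ∈ 𝓕 | T ⊆ A} with h𝓗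
    have hsplit : #𝓗 + #𝓖 = #𝓕 := card_filter_add_card_filter_not (s := 𝓕) (T ⊆ ·)
    have h𝓖sub : ∀ A ∈ 𝓖, A ⊂ T := by
      intro A hA
      obtain ⟨hA, hTA⟩ := mem_filter.1 hA
      refine ⟨fun j hj => ?_, hTA⟩
      by_contra hjT
      exact hTA fun i hi => htop A hA i hi j (mem_sdiff.2 ⟨hsub A hA hj, hjT⟩) hj
    have h𝓖diff : ∀ i ∈ T, ∀ j ∈ T, diffCount 𝓖 i j = diffCount 𝓕 i j := by
      intro i hi j hj
      unfold diffCount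
      congr 1
      ext A
      simp only [mem_filter, h𝓖]
      have := fun h : T ⊆ A => h hj
      tauto
    have hcomp := five_mul_card_le_of_no_gap hTne h𝓖sub
      (fun i hi j hj => by
        rw [h𝓖diff i hi j hj, h𝓖diff j hj i hi]
        exact hb i (hTS hi) j (hTS hj))
      (fun U hU hUne => by
        by_contra! hcon
        -- A gap inside T for `𝓖` is one for `𝓕`: the discarded sets contain all of T and shift its
        -- counts equally.
        refine hmin U hU ⟨hUne, fun i hi j hj => ?_⟩
        by_cases hjT : j ∈ T
        · have h1 := hcon i hi j (mem_sdiff.2 ⟨hjT, (mem_sdiff.1 hj).2⟩)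
          have h2 := rowCount_add_diffCount 𝓖 i j
          have h3 := rowCount_add_diffCount 𝓕 i j
          rw [h𝓖diff _ (hU.1 hi) _ hjT, h𝓖diff _ hjT _ (hU.1 hi)] at h2
          omega
        · exact hTop i (hU.1 hi) j (mem_sdiff.2 ⟨(mem_sdiff.1 hj).1, hjT⟩))
    have hinj : Set.InjOn (fun A => A \ T) (𝓗 : Set (Finset α)) := by
      intro A hA B hB hAB
      have hA' := (mem_filter.1 hA).2
      have hB' := (mem_filter.1 hB).2
      rw [← sdiff_union_of_subset hA', ← sdiff_union_of_subset hB']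
      exact congrArg (· ∪ T) hAB
    have hcard : #(𝓗.image fun A => A \ T) = #𝓗 := card_image_of_injOn hinj
    have hdiff : ∀ i ∈ S \ T, ∀ j ∈ S \ T,
        diffCount (𝓗.image fun A => A \ T) i j = diffCount 𝓕 i j := by
      intro i hi j hj
      unfold diffCount
      rw [filter_image, card_image_of_injOn (hinj.mono (coe_subset.2 (filter_subset _ _)))]
      congr 1
      ext A
      simp only [mem_filter, h𝓗, mem_sdiff, (mem_sdiff.1 hi).2, (mem_sdiff.1 hj).2,
        not_false_eq_true, and_true]
      have := fun (hA : A ∈ 𝓕) (h : i ∈ A) (k : α) (hk : k ∈ T) => htop A hA k hk i hi h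
      constructor
      · tauto
      · exact fun h => ⟨⟨h.1, this h.1 h.2.1⟩, h.2⟩
    obtain ⟨hle, heq⟩ := ih (S \ T) (sdiff_ssubset hTS hTne) (𝓗.image fun A => A \ T)
      (by
        intro B hB
        obtain ⟨A, hA, rfl⟩ := mem_image.1 hB
        exact sdiff_subset_sdiff (hsub A (mem_filter.1 hA).1) le_rfl)
      (by
        intro i hi j hj
        rw [hdiff i hi j hj, hdiff j hj i hi]
        exact hb i (mem_sdiff.1 hi).1 j (mem_sdiff.1 hj).1)
    have hST := card_sdiff_add_card_eq_card hTS
    rw [hcard] at hle heq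
    refine ⟨by omega, fun h => ?_⟩
    obtain ⟨t, b, hbt, hb5, hbA⟩ := heq (by omega)
    have hT5 := hcomp.2 (by omega)
    -- T has the largest counts, so it becomes block 0 and the later blocks shift by one.
    refine ⟨t + 1, fun i => if i ∈ T then 0 else b i + 1, ?_, ?_, ?_⟩
    · intro i hi
      dsimp only
      split_ifs with hiT
      · omega
      · have := hbt i (mem_sdiff.2 ⟨hi, hiT⟩)
        omega
    · rintro (_ | s) hs
      · rw [← hT5]
        congr 1
        ext i
        have := @hTS i
        simp
        tauto
      · rw [← hb5 s (by omega)]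
        congr 1
        ext i
        simp only [mem_filter, mem_sdiff]
        by_cases hiT : i ∈ T
        · simp only [hiT, if_true, not_true_eq_false, and_false, false_and, iff_false, not_and]
          omega
        · simp only [hiT, if_false, not_false_eq_true, and_true, add_left_inj]
    · intro A hA i hi j hj hij hjA
      dsimp only at hij
      split_ifs at hij with hiT hjT hjT
      · omega
      · exact htop A hA i hiT j (mem_sdiff.2 ⟨hj, hjT⟩) hjA
      · omega
      · have hTA : T ⊆ A := fun k hk => htop A hA k hk j (mem_sdiff.2 ⟨hj, hjT⟩) hjA
        have := hbA (A \ T) (mem_image_of_mem _ (mem_filter.2 ⟨hA, hTA⟩)) i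
          (mem_sdiff.2 ⟨hi, hiT⟩) j (mem_sdiff.2 ⟨hj, hjT⟩) (by omega)
          (mem_sdiff.2 ⟨hjA, hjT⟩)
        exact (mem_sdiff.1 this).1

end General

/-! ### From matrices to set families -/

/-- The set of rows in which the given column has a 1. -/
def colSet {α β : Type*} [Fintype α] (A : Matrix α β (Fin 2)) (k : β) : Finset α :=
  {i | A i k = 1}

theorem IsSimple.colSet_injective {α β : Type*} [Fintype α] {A : Matrix α β (Fin 2)}
    (hA : IsSimple A) : Function.Injective (colSet A) := by
  intro k l h
  refine hA (funext fun i => ?_)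
  have : A i k = 1 ↔ A i l = 1 := by simpa [colSet] using Finset.ext_iff.1 h i
  simp only [Matrix.transpose_apply]
  omega

section Configurations

variable {α β : Type*} {A : Matrix α β (Fin 2)}

theorem isConfig_F0p10 {p : ℕ} {i j : α} (f : Fin p ↪ β) (hf : ∀ k, A i (f k) = 1 ∧ A j (f k) = 0)
    {q : β} (hq : A i q = 0 ∧ A j q = 1) : IsConfig (F0p10 p) A := by
  have hij : i ≠ j := by
    rintro rfl
    exact absurd (hq.1.symm.trans hq.2) (by decide)
  refine ⟨⟨![i, j], ?_⟩, ⟨Fin.snoc (α := fun _ => β) f q, ?_⟩, ?_⟩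
  · intro x y
    fin_cases x <;> fin_cases y <;> simp [hij, hij.symm]
  · refine Fin.snoc_injective_iff.2 ⟨f.injective, ?_⟩
    rintro ⟨k, hk⟩
    have := (hf k).1
    rw [hk, hq.1] at this
    exact absurd this (by decide)
  · refine funext fun x => funext fun k => ?_
    change A (![i, j] x) (Fin.snoc (α := fun _ => β) f q k) = F0p10 p x k
    revert x
    rw [Fin.forall_fin_two]
    induction k using Fin.lastCases with
    | last => simp [F0p10, hq]
    | cast k => simp [F0p10, hf]

theorem exists_of_isConfig_F0p10 {p : ℕ} (h : IsConfig (F0p10 p) A) :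
    ∃ (i j : α) (f : Fin p ↪ β) (q : β), (∀ k, A i (f k) = 1 ∧ A j (f k) = 0) ∧
      A i q = 0 ∧ A j q = 1 := by
  obtain ⟨r, c, h⟩ := h
  have h' : ∀ x k, A (r x) (c k) = F0p10 p x k := fun x k => congrFun (congrFun h x) k
  exact ⟨r 0, r 1, Fin.castSuccEmb.trans c, c (Fin.last p),
    fun k => ⟨by simp [h', F0p10], by simp [h', F0p10]⟩, by simp [h', F0p10], by simp [h', F0p10]⟩

theorem IsConfig.of_submatrix {κ ι γ δ : Type*} {F : Matrix κ ι (Fin 2)} (e : γ ≃ α) (f : δ ≃ β)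
    (h : IsConfig F (A.submatrix e f)) : IsConfig F A := by
  obtain ⟨r, c, h⟩ := h
  exact ⟨r.trans e.toEmbedding, c.trans f.toEmbedding, h⟩

theorem IsSimple.submatrix {γ δ : Type*} (hA : IsSimple A) (e : γ ≃ α) (f : δ ≃ β) :
    IsSimple (A.submatrix e f) := by
  intro k l h
  refine f.injective (hA (funext fun i => ?_))
  simpa using congrFun h (e.symm i)

end Configurations

section Bound

variable {m n : ℕ} {A : Matrix (Fin m) (Fin n) (Fin 2)}

theorem diffCount_image_colSet (hA : IsSimple A) (i j : Fin m) :
    diffCount (univ.image (colSet A)) i j = #{k | A i k = 1 ∧ A j k = 0} := by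
  unfold diffCount
  rw [filter_image, card_image_of_injective _ hA.colSet_injective]
  congr 1
  ext k
  simp only [colSet, mem_filter, mem_univ, true_and]
  have : ∀ x : Fin 2, x ≠ 1 ↔ x = 0 := by decide
  simp [this]

theorem diffBounded_image_colSet (hA : A ∈ Avoid m n (F0p10 9)) :
    DiffBounded (univ.image (colSet A)) univ := by
  intro i _ j _ h
  rw [diffCount_image_colSet hA.1] at h ⊢
  by_contra hne
  obtain ⟨q, hq⟩ := card_pos.1 (Nat.pos_of_ne_zero hne)
  obtain ⟨f⟩ : Nonempty (Fin 9 ↪ ({k | A i k = 1 ∧ A j k = 0} : Finset (Fin n))) :=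
    Function.Embedding.nonempty_of_card_le (by
      rwa [Fintype.card_coe, Fintype.card_fin])
  refine hA.2 (isConfig_F0p10 (i := i) (j := j) (q := q)
    (f.trans (Function.Embedding.subtype _)) (fun k => ?_) ?_)
  · exact (mem_filter.1 (f k).2).2
  · simpa [and_comm] using hq

theorem card_image_colSet (hA : IsSimple A) : #(univ.image (colSet A)) = n := by
  rw [card_image_of_injective _ hA.colSet_injective, card_univ, Fintype.card_fin]

theorem five_mul_le_of_mem_avoid (hA : A ∈ Avoid m n (F0p10 9)) : 5 * n ≤ 31 * m + 5 := by
  have := (five_mul_card_le univ _ (fun _ _ => subset_univ _) (diffBounded_image_colSet hA)).1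
  rwa [card_image_colSet hA.1, card_univ, Fintype.card_fin] at this

end Bound

/-! ### The triangular matrix and the extremal case -/

section Triangular

theorem card_KMinusOnes_columns :
    Fintype.card {c : Fin 5 → Fin 2 // c ≠ fun _ => 1} = 31 := by
  rw [Fintype.card_subtype_compl]
  simp

theorem isSimple_triangular (t k : ℕ) : IsSimple (triangular t (KMinusOnes k)) := by
  have hzero : ∀ y : {c : Fin k → Fin 2 // c ≠ fun _ => 1}, ∃ x, y.1 x = 0 := by
    rintro ⟨c, hc⟩
    by_contra! h
    refine hc (funext fun x => ?_)
    have := h x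
    dsimp only at this
    omega
  have hle : ∀ (s s' : Fin t) (y y' : {c : Fin k → Fin 2 // c ≠ fun _ => 1}),
      (triangular t (KMinusOnes k)).transpose (Sum.inl (s, y)) =
        (triangular t (KMinusOnes k)).transpose (Sum.inl (s', y')) → s' ≤ s := by
    intro s s' y y' h
    by_contra! hlt
    obtain ⟨x, hx⟩ := hzero y
    have := congrFun h (s, x)
    simp [triangular, KMinusOnes, K, hx, hlt, hlt.ne] at this
  rintro (⟨s, y⟩ | _) (⟨s', y'⟩ | _) h
  · obtain rfl := le_antisymm (hle s' s y' y h.symm) (hle s s' y y' h)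
    have : y = y' := Subtype.ext (funext fun x => by
      simpa [triangular, KMinusOnes, K] using congrFun h (s, x))
    rw [this]
  · obtain ⟨x, hx⟩ := hzero y
    have := congrFun h (s, x)
    simp [triangular, KMinusOnes, K, hx] at this
  · obtain ⟨x, hx⟩ := hzero y'
    have := congrFun h (s', x)
    simp [triangular, KMinusOnes, K, hx] at this
  · rfl

theorem triangular_mono {κ ι : Type*} {t : ℕ} {B : Matrix κ ι (Fin 2)} {x x' : Fin t × κ}
    (hx : x.1 < x'.1) (y : (Fin t × ι) ⊕ Unit) (h : triangular t B x' y = 1) :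
    triangular t B x y = 1 := by
  rcases y with ⟨s, y⟩ | _
  · have hs : x'.1 ≤ s := by
      by_contra! hlt
      simp [triangular, hlt.ne', hlt.not_gt] at h
    have := hx.trans_le hs
    simp [triangular, this, this.ne]
  · rfl

/-- Rows in different blocks are comparable. Two rows of one block differ only in its own columns,
with at most 2³ = 8 of each kind. -/
theorem not_isConfig_triangular (t : ℕ) :
    ¬ IsConfig (F0p10 9) (triangular t (KMinusOnes 5)) := by
  intro h
  obtain ⟨⟨s, x⟩, ⟨s', x'⟩, f, q, hf, hq, hq'⟩ := exists_of_isConfig_F0p10 h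
  rcases lt_trichotomy s s' with hlt | rfl | hlt
  · rw [triangular_mono hlt q hq'] at hq
    exact absurd hq (by decide)
  · have hcol : ∀ k, ∃ c : Fin 5 → Fin 2, c x = 1 ∧ c x' = 0 ∧
        ∃ hc, f k = Sum.inl (s, ⟨c, hc⟩) := by
      intro k
      obtain ⟨h1, h0⟩ := hf k
      rcases hk : f k with ⟨u, c, hc⟩ | _
      · rw [hk] at h1 h0
        have hsu : s = u := by
          by_contra hne
          simp only [triangular, Matrix.of_apply, hne, if_false] at h1 h0
          exact absurd (h0.symm.trans h1) (by decide)
        subst hsu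
        simp only [triangular, Matrix.of_apply, if_true, KMinusOnes, K, Matrix.submatrix_apply,
          id_eq] at h1 h0
        exact ⟨c, h1, h0, hc, rfl⟩
      · rw [hk] at h0
        exact absurd h0 (by simp [triangular])
    choose g hg1 hg0 hgc hgf using hcol
    have hinj : Function.Injective g := by
      intro k l hkl
      apply f.injective
      rw [hgf, hgf]
      simp [hkl]
    have hcard : ∀ x x' : Fin 5, #{c : Fin 5 → Fin 2 | c x = 1 ∧ c x' = 0} ≤ 8 := by decide
    have h9 := card_le_card_of_injOn (s := univ) (t := {c | c x = 1 ∧ c x' = 0}) g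
      (fun k _ => by simp [hg1, hg0]) hinj.injOn
    have := h9.trans (hcard x x')
    simp at this
  · have h1 := triangular_mono (x := (s', x')) (x' := (s, x)) hlt (f 0) (hf 0).1
    rw [(hf 0).2] at h1
    exact absurd h1 (by decide)

theorem PermEquiv.mem_avoid_triangular {m n t : ℕ} {A : Matrix (Fin m) (Fin n) (Fin 2)}
    (h : PermEquiv A (triangular t (KMinusOnes 5))) :
    A ∈ Avoid m n (F0p10 9) ∧ n = 31 * t + 1 := by
  obtain ⟨e, f, rfl⟩ := h
  refine ⟨⟨(isSimple_triangular t 5).submatrix e f,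
    fun h => not_isConfig_triangular t (h.of_submatrix e f)⟩, ?_⟩
  have := Fintype.card_congr f
  rw [Fintype.card_fin, Fintype.card_sum, Fintype.card_prod, card_KMinusOnes_columns] at this
  simpa [mul_comm] using this

theorem exists_permEquiv_triangular (t : ℕ) :
    ∃ A : Matrix (Fin (5 * t)) (Fin (31 * t + 1)) (Fin 2),
      PermEquiv A (triangular t (KMinusOnes 5)) := by
  have e : Fin (5 * t) ≃ Fin t × Fin 5 := Fintype.equivOfCardEq (by simp [mul_comm])
  have f : Fin (31 * t + 1) ≃
      (Fin t × {c : Fin 5 → Fin 2 // c ≠ fun _ => 1}) ⊕ Unit := Fintype.equivOfCardEq (by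
    rw [Fintype.card_fin, Fintype.card_sum, Fintype.card_prod, card_KMinusOnes_columns]
    simp [mul_comm])
  exact ⟨_, e, f, rfl⟩

/-- Rows respecting a linear order of the blocks only admit columns of the triangular matrix. -/
theorem exists_column_triangular {t k : ℕ} (v : Fin t × Fin k → Fin 2)
    (hv : ∀ x x', x.1 < x'.1 → v x' = 1 → v x = 1) :
    ∃ y, ∀ x, v x = triangular t (KMinusOnes k) x y := by
  by_cases hfull : ∀ x, v x = 1
  · exact ⟨Sum.inr (), hfull⟩
  have hbit : ∀ z : Fin 2, z ≠ 1 ↔ z = 0 := by decide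
  have hne : ({s | ∃ x, v (s, x) = 0} : Finset (Fin t)).Nonempty := by
    push Not at hfull
    obtain ⟨⟨s, x⟩, hx⟩ := hfull
    exact ⟨s, by simpa using ⟨x, (hbit _).1 hx⟩⟩
  -- The first block containing a 0 is the diagonal one: earlier blocks are all 1, and later ones
  -- must be all 0.
  obtain ⟨s, hs, hmin⟩ := exists_minimal hne
  obtain ⟨x₀, hx₀⟩ : ∃ x, v (s, x) = 0 := by simpa using hs
  refine ⟨Sum.inl (s, ⟨fun x => v (s, x), fun h => ?_⟩), ?_⟩
  · have := congrFun h x₀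
    rw [hx₀] at this
    exact absurd this (by decide)
  · rintro ⟨u, x⟩
    rcases lt_trichotomy u s with hlt | rfl | hlt
    · have : v (u, x) = 1 := by
        by_contra hux
        exact hlt.not_ge (hmin (by simpa using ⟨x, (hbit _).1 hux⟩) hlt.le)
      simp [triangular, this, hlt, hlt.ne]
    · simp [triangular, KMinusOnes, K]
    · have : v (u, x) = 0 := by
        rw [← hbit]
        intro hux
        have := hv (s, x₀) (u, x) hlt hux
        rw [hx₀] at this
        exact absurd this (by decide)
      simp [triangular, this, hlt.not_gt, hlt.ne']

theorem exists_block_equiv {m t k : ℕ} (b : Fin m → ℕ) (hbt : ∀ i, b i < t)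
    (hb : ∀ s < t, #{i | b i = s} = k) :
    ∃ e : Fin m ≃ Fin t × Fin k, ∀ i, ((e i).1 : ℕ) = b i := by
  have g : ∀ s : Fin t, {i : Fin m // (⟨b i, hbt i⟩ : Fin t) = s} ≃ Fin k := fun s =>
    Fintype.equivFinOfCardEq (by
      rw [Fintype.card_subtype, ← hb s s.2]
      simp [Fin.ext_iff])
  exact ⟨(Equiv.sigmaFiberEquiv fun i => (⟨b i, hbt i⟩ : Fin t)).symm.trans
    ((Equiv.sigmaCongrRight g).trans (Equiv.sigmaEquivProd _ _)), fun i => rfl⟩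

theorem permEquiv_triangular_of_mem_avoid {t n : ℕ} {A : Matrix (Fin (5 * t)) (Fin n) (Fin 2)}
    (hA : A ∈ Avoid (5 * t) n (F0p10 9)) (hn : n = 31 * t + 1) :
    PermEquiv A (triangular t (KMinusOnes 5)) := by
  obtain ⟨t', b, hbt, hb5, hbA⟩ :=
    (five_mul_card_le univ _ (fun _ _ => subset_univ _) (diffBounded_image_colSet hA)).2 (by
      rw [card_image_colSet hA.1, card_univ, Fintype.card_fin]
      omega)
  obtain ⟨e, he⟩ := exists_block_equiv b (fun i => hbt i (mem_univ i)) hb5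
  obtain rfl : t' = t := by
    have := Fintype.card_congr e
    simp at this
    omega
  have hcol : ∀ k, ∃ y, ∀ x, A (e.symm x) k = triangular t' (KMinusOnes 5) x y := by
    intro k
    refine exists_column_triangular (fun x => A (e.symm x) k) fun x x' hx h => ?_
    have := hbA (colSet A k) (mem_image_of_mem _ (mem_univ k)) (e.symm x) (mem_univ _)
      (e.symm x') (mem_univ _) (by simpa [← he] using hx) (by simpa [colSet] using h)
    simpa [colSet] using this
  choose f hf using hcol
  have hinj : Function.Injective f := by
    intro k l hkl
    refine hA.1 (funext fun i => ?_)
    have h1 := hf k (e i)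
    have h2 := hf l (e i)
    rw [e.symm_apply_apply] at h1 h2
    rw [Matrix.transpose_apply, Matrix.transpose_apply, h1, h2, hkl]
  -- Both matrices have 31t + 1 columns, so every admissible column occurs.
  have hbij : Function.Bijective f := (Fintype.bijective_iff_injective_and_card f).2 ⟨hinj, by
    rw [Fintype.card_fin, Fintype.card_sum, Fintype.card_prod, card_KMinusOnes_columns, hn]
    simp [mul_comm]⟩
  refine ⟨e, Equiv.ofBijective f hbij, ?_⟩
  ext i k
  have := hf k (e i)
  rw [e.symm_apply_apply] at this
  simp [this]

end Triangular

end ForbConfig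

theorem mainTheorem5 :
    (∀ m : ℕ, ForbConfig.forb m (ForbConfig.F0p10 9) ≤ ⌊(31 / 5 : ℚ) * (m : ℚ)⌋₊ + 1) ∧
    (∀ m : ℕ, m ≡ 0 [MOD 5] →
      ForbConfig.forb m (ForbConfig.F0p10 9) = ⌊(31 / 5 : ℚ) * (m : ℚ)⌋₊ + 1 ∧
      ∀ (n : ℕ) (A : Matrix (Fin m) (Fin n) (Fin 2)),
        ForbConfig.IsExtremal (ForbConfig.F0p10 9) A ↔
          ForbConfig.PermEquiv A
            (ForbConfig.triangular (m / 5) (ForbConfig.KMinusOnes 5))) := by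
  have hfloor : ∀ m : ℕ, ⌊(31 / 5 : ℚ) * (m : ℚ)⌋₊ = 31 * m / 5 := by
    intro m
    rw [← Nat.floor_div_eq_div (K := ℚ)]
    congr 1
    push_cast
    ring
  have hle : ∀ m : ℕ, 5 * ForbConfig.forb m (ForbConfig.F0p10 9) ≤ 31 * m + 5 := by
    intro m
    obtain ⟨A, hA⟩ := (ForbConfig.isGreatest_forb m (ForbConfig.F0p10 9)).1
    exact ForbConfig.five_mul_le_of_mem_avoid hA
  refine ⟨fun m => ?_, fun m hm => ?_⟩
  · have := hle m
    rw [hfloor]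
    omega
  · obtain ⟨t, rfl⟩ := (Nat.modEq_zero_iff_dvd).1 hm
    have hforb : ForbConfig.forb (5 * t) (ForbConfig.F0p10 9) = 31 * t + 1 := by
      obtain ⟨A, hA⟩ := ForbConfig.exists_permEquiv_triangular t
      have h1 := (ForbConfig.isGreatest_forb (5 * t) (ForbConfig.F0p10 9)).2
        ⟨A, hA.mem_avoid_triangular.1⟩
      have h2 := hle (5 * t)
      omega
    rw [Nat.mul_div_cancel_left t (by norm_num)]
    refine ⟨by rw [hforb, hfloor]; omega, fun n A => ⟨fun h => ?_, fun h => ?_⟩⟩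
    · exact ForbConfig.permEquiv_triangular_of_mem_avoid h.1 (h.2.trans hforb)
    · exact ⟨h.mem_avoid_triangular.1, h.mem_avoid_triangular.2.trans hforb.symm⟩
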